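/- Conventions. Let $\Gamma$ be a discrete group. A positivity domain is a subset $\Delta\subseteq\Gamma$ with $e\in\Delta$ and $\Delta^{-1}=\Delta$. For a subset $\Sigma\subseteq\Gamma$ put $\mathrm{S}[\Sigma]=\mathrm{span}\{\delta_s\mid s\in\Sigma\}\subseteq\mathbb{C}[\Gamma]$, where $\delta_s^*=\delta_{s^{-1}}$; thus $\mathrm{S}[\Delta]$ is a $*$-vector space. For a finite $\Sigma\subseteq\Gamma$ and $n\in\mathbb{N}$, let $\mathcal{Q}_n(\Sigma)$ be the set of finite sums $\sum_i y_iy_i^*$ with $y_i\in\mathrm{M}_n(\mathrm{S}[\Sigma])$ (products in $\mathrm{M}_n(\mathbb{C}[\Gamma])$), and let $\mathcal{U}_n(\Delta)\subseteq\mathrm{M}_n(\mathrm{S}[\Delta])$ be the convex cone generated by all $\mathcal{Q}_n(\Sigma)$ with $\Sigma\subseteq\Gamma$ finite and $\Sigma\Sigma^{-1}\subseteq\Delta$. Write $\mathrm{UOS}_0(\Delta)$ for the matrix order unit space $(\mathrm{S}[\Delta],(\mathcal{U}_n(\Delta))_n,\delta_e)$, and $\mathrm{UOS}(\Delta)$ for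 its Archimedeanisation. Here the Archimedeanisation of a matrix order unit space $(X,(\mathrm{M}_n(X)^+)_n,e)$ has underlying space $X/N$, where $N$ is the intersection of the kernels of all states of $X$, and unit $e+N$; an element $x+\mathrm{M}_n(N)$ of $\mathrm{M}_n(X/N)=\mathrm{M}_n(X)/\mathrm{M}_n(N)$ is positive if $re_n+x\in\mathrm{M}_n(X)^++\mathrm{M}_n(N)$ for all $r>0$, where $e_n=\mathrm{diag}(e,\dots,e)$. For operator systems $X,Y$, the maximal tensor product $X\otimes_{\max}Y$ is the algebraic tensor product $X\otimes Y$ with unit $e_X\otimes e_Y$, in which $z\in\mathrm{M}_n(X\otimes Y)$ is positive if $r(e_X\otimes e_Y)_n+z\in\mathcal{D}_n^{\max}(X,Y)$ for all $r>0$, where $\mathcal{D}_n^{\max}(X,Y)=\{A(x\otimes y)A^*\mid k,\ell\in\mathbb{N},\ x\in\mathrm{M}_k(X)^+,\ y\in\mathrm{M}_\ell(Y)^+,\ A\in\mathrm{M}_{n,k\ell}(\mathbb{C})\}$. A complete order isomorphism is a self-adjoint linear bijection $\phi$ such that, for every $n$, the entrywise maps $\phi^{(n)}$ and $(\phi^{-1})^{(n)}$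 on $n\times n$ matrices are positive. Theorem. Let $\Gamma,\Gamma'$ be discrete groups and let $\Delta\subseteq\Gamma$, $\Delta'\subseteq\Gamma'$ be positivity domains. Then $\mathrm{UOS}(\Delta\times\Delta')$, formed with respect to $\Delta\times\Delta'\subseteq\Gamma\times\Gamma'$, is completely order isomorphic to $\mathrm{UOS}(\Delta)\otimes_{\max}\mathrm{UOS}(\Delta')$. More precisely, there is a unital complete order isomorphism $\mathrm{UOS}(\Delta\times\Delta')\to\mathrm{UOS}(\Delta)\otimes_{\max}\mathrm{UOS}(\Delta')$ that sends the class of $\delta_{(s,t)}$ to $[\delta_s]\otimes[\delta_t]$ for all $s\in\Delta$, $t\in\Delta'$. -/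

import Mathlib

open scoped Pointwise TensorProduct

noncomputable section

/-! ## The `*`-algebra `ℂ[Γ]` of a discrete group -/

namespace MonoidAlgebra

variable {Γ : Type*} [Group Γ]

/-- The involution of `ℂ[Γ]`: the conjugate-linear map with `δ_s ↦ δ_{s⁻¹}`. -/
def involution (f : MonoidAlgebra ℂ Γ) : MonoidAlgebra ℂ Γ :=
  MonoidAlgebra.ofCoeff
    ((f.coeff.mapRange (starRingEnd ℂ) (map_zero _)).equivMapDomain (Equiv.inv Γ))

instance instStarGroupAlgebra : Star (MonoidAlgebra ℂ Γ) := ⟨involution⟩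

theorem star_coeff_apply (f : MonoidAlgebra ℂ Γ) (s : Γ) :
    (star f).coeff s = star (f.coeff s⁻¹) := rfl

theorem star_single (s : Γ) (c : ℂ) :
    star (MonoidAlgebra.single s c) = MonoidAlgebra.single s⁻¹ (star c) := by
  ext t
  rw [star_coeff_apply]
  classical
  simp only [MonoidAlgebra.coeff_single, Finsupp.single_apply]
  have h : (s = t⁻¹) = (s⁻¹ = t) := by
    rw [eq_iff_iff]; exact eq_inv_iff_mul_eq_one.trans inv_eq_iff_mul_eq_one.symm
  simp only [h]
  split_ifs <;> simp

theorem star_add' (f g : MonoidAlgebra ℂ Γ) : star (f + g) = star f + star g := by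
  ext s; simp [star_coeff_apply]

instance instStarRingGroupAlgebra : StarRing (MonoidAlgebra ℂ Γ) where
  star_involutive f := by ext s; simp [star_coeff_apply]
  star_add := star_add'
  star_mul f g := by
    induction f using MonoidAlgebra.induction_linear with
    | zero =>
      have h : star (0 : MonoidAlgebra ℂ Γ) = 0 := by ext s; simp [star_coeff_apply]
      simp [h]
    | add f₁ f₂ h₁ h₂ => rw [add_mul, star_add', h₁, h₂, star_add', mul_add]
    | single s a =>
      induction g using MonoidAlgebra.induction_linear with
      | zero =>
        have h : star (0 : MonoidAlgebra ℂ Γ) = 0 := by ext s; simp [star_coeff_apply]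
        simp [h]
      | add g₁ g₂ h₁ h₂ => rw [mul_add, star_add', h₁, h₂, star_add', add_mul]
      | single t b =>
        rw [MonoidAlgebra.single_mul_single, star_single, star_single, star_single,
          MonoidAlgebra.single_mul_single, mul_inv_rev, star_mul]

instance instStarModuleGroupAlgebra : StarModule ℂ (MonoidAlgebra ℂ Γ) where
  star_smul c f := by ext s; simp [star_coeff_apply]

end MonoidAlgebra

/-! ## Complex `*`-vector spaces with matrix cones and a unit -/

/-- A complex `*`-vector space `V` together with a distinguished element `e` and, for every `n`,
a set of "positive" elements of `M_n(V)`. Matrix order unit spaces and operator systems are such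
triples `(V, (M_n(V)⁺)_n, e)`, and every instance constructed below is given by explicit cones. -/
structure MatrixConeSpace where
  carrier : Type*
  [addCommGroup : AddCommGroup carrier]
  [module : Module ℂ carrier]
  [starAddMonoid : StarAddMonoid carrier]
  [starModule : StarModule ℂ carrier]
  pos : ∀ n : ℕ, Set (Matrix (Fin n) (Fin n) carrier)
  unit : carrier

namespace MatrixConeSpace

attribute [instance] addCommGroup module starAddMonoid starModule

/-- The diagonal matrix `e_n ∈ M_n(V)` with diagonal entries `e`. -/
def matrixUnit (X : MatrixConeSpace) (n : ℕ) : Matrix (Fin n) (Fin n) X.carrier :=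
  Matrix.diagonal fun _ => X.unit

/-- `V⁺`, the cone at the first matrix level, under `M_1(V) = V`. -/
def posOne (X : MatrixConeSpace) : Set X.carrier :=
  {v | (Matrix.of fun _ _ => v) ∈ X.pos 1}

/-- A linear isomorphism `φ` is a complete order isomorphism if it is self-adjoint and, for every
`n`, both `φ⁽ⁿ⁾` and its inverse map positive matrices to positive matrices. -/
def IsCompleteOrderIso {X Y : MatrixConeSpace} (φ : X.carrier ≃ₗ[ℂ] Y.carrier) : Prop :=
  (∀ v, φ (star v) = star (φ v)) ∧
    ∀ n : ℕ, (∀ x ∈ X.pos n, x.map φ ∈ Y.pos n) ∧ (∀ y ∈ Y.pos n, y.map φ.symm ∈ X.pos n)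

/-! ### Archimedeanisation -/

/-- States: unital positive (in particular self-adjoint) linear functionals. -/
def IsState (X : MatrixConeSpace) (φ : X.carrier →ₗ[ℂ] ℂ) : Prop :=
  (∀ v, φ (star v) = star (φ v)) ∧ (∀ v ∈ X.posOne, ∃ r : ℝ, 0 ≤ r ∧ φ v = r) ∧ φ X.unit = 1

/-- `N = ⋂ ker φ`, the intersection over all states `φ`. -/
def stateKernel (X : MatrixConeSpace) : Submodule ℂ X.carrier :=
  ⨅ φ : {φ : X.carrier →ₗ[ℂ] ℂ // X.IsState φ}, LinearMap.ker φ.1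

theorem mem_stateKernel {X : MatrixConeSpace} {v : X.carrier} :
    v ∈ X.stateKernel ↔ ∀ φ : X.carrier →ₗ[ℂ] ℂ, X.IsState φ → φ v = 0 := by
  simp [stateKernel, Submodule.mem_iInf]

theorem star_mem_stateKernel {X : MatrixConeSpace} {v : X.carrier} (hv : v ∈ X.stateKernel) :
    star v ∈ X.stateKernel := by
  rw [mem_stateKernel] at hv ⊢
  intro φ hφ
  rw [hφ.1, hv φ hφ, star_zero]

/-- The involution of `V / N` induced by that of `V`. -/
instance instStarQuotient (X : MatrixConeSpace) : StarAddMonoid (X.carrier ⧸ X.stateKernel) where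
  star := QuotientAddGroup.map X.stateKernel.toAddSubgroup X.stateKernel.toAddSubgroup
    (starAddEquiv : X.carrier ≃+ X.carrier).toAddMonoidHom fun _ hv => star_mem_stateKernel hv
  star_involutive := by
    rintro ⟨v⟩
    exact congrArg X.stateKernel.mkQ (star_star v)
  star_add a b := map_add _ a b

theorem star_mkQ (X : MatrixConeSpace) (v : X.carrier) :
    star (X.stateKernel.mkQ v) = X.stateKernel.mkQ (star v) := rfl

instance instStarModuleQuotient (X : MatrixConeSpace) :
    StarModule ℂ (X.carrier ⧸ X.stateKernel) where
  star_smul c := by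
    rintro ⟨v⟩
    exact congrArg X.stateKernel.mkQ (star_smul c v)

/-- The Archimedeanisation of `(V, (C_n)_n, e)`: the space `V / N` with unit `e + N`, where
`x ∈ M_n(V / N) = M_n(V) / M_n(N)` is positive if, for every real `r > 0`, the element
`r e_n + x` lies in the image of `C_n`. -/
def arch (X : MatrixConeSpace) : MatrixConeSpace where
  carrier := X.carrier ⧸ X.stateKernel
  pos n := {x | ∀ r : ℝ, 0 < r → ∃ y ∈ X.pos n,
    (r : ℂ) • (X.matrixUnit n).map X.stateKernel.mkQ + x = y.map X.stateKernel.mkQ}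
  unit := X.stateKernel.mkQ X.unit

/-! ### The maximal tensor product -/

/-- `A z A*`, for a scalar matrix `A` and a matrix `z` over a complex vector space. -/
def conjugate {V : Type*} [AddCommGroup V] [Module ℂ V] {m n : Type*} [Fintype m]
    (A : Matrix n m ℂ) (z : Matrix m m V) : Matrix n n V :=
  Matrix.of fun i j => ∑ p, ∑ q, (A i p * star (A j q)) • z p q

/-- `x ⊗ y ∈ M_{kl}(V ⊗ W)`, for `x ∈ M_k(V)` and `y ∈ M_l(W)`; rows and columns are indexed by
pairs. -/
def matrixTensor {V W : Type*} [AddCommGroup V] [Module ℂ V] [AddCommGroup W] [Module ℂ W]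
    {k l : ℕ} (x : Matrix (Fin k) (Fin k) V) (y : Matrix (Fin l) (Fin l) W) :
    Matrix (Fin k × Fin l) (Fin k × Fin l) (V ⊗[ℂ] W) :=
  Matrix.kroneckerMap (fun v w => v ⊗ₜ[ℂ] w) x y

/-- `D_n^max(X, Y) = {A (x ⊗ y) A* | x ∈ M_k(X)⁺, y ∈ M_l(Y)⁺, A ∈ M_{n,kl}}`. -/
def maxCone (X Y : MatrixConeSpace) (n : ℕ) :
    Set (Matrix (Fin n) (Fin n) (X.carrier ⊗[ℂ] Y.carrier)) :=
  {z | ∃ (k l : ℕ) (x : Matrix (Fin k) (Fin k) X.carrier) (y : Matrix (Fin l) (Fin l) Y.carrier)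
    (A : Matrix (Fin n) (Fin k × Fin l) ℂ),
    x ∈ X.pos k ∧ y ∈ Y.pos l ∧ z = conjugate A (matrixTensor x y)}

/-- The maximal tensor product `X ⊗_max Y` of operator systems: the algebraic tensor product with
`(v ⊗ w)* = v* ⊗ w*`, unit `e_X ⊗ e_Y`, and the Archimedeanisation of the cones `D_n^max(X, Y)`:
`z` is positive if `r (e_X ⊗ e_Y)_n + z ∈ D_n^max(X, Y)` for every real `r > 0`. -/
def maxTensor (X Y : MatrixConeSpace) : MatrixConeSpace where
  carrier := X.carrier ⊗[ℂ] Y.carrier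
  pos n := {z | ∀ r : ℝ, 0 < r →
    (r : ℂ) • (Matrix.diagonal fun _ => X.unit ⊗ₜ[ℂ] Y.unit) + z ∈ maxCone X Y n}
  unit := X.unit ⊗ₜ[ℂ] Y.unit

/-- The elementary tensor `v ⊗ w` in `X ⊗_max Y`. -/
def maxTensor.tmul {X Y : MatrixConeSpace} (v : X.carrier) (w : Y.carrier) :
    (maxTensor X Y).carrier :=
  v ⊗ₜ[ℂ] w

end MatrixConeSpace

/-! ## Positivity domains and `UOS(Δ)` -/

/-- A positivity domain in a discrete group `Γ`: a subset `Δ` with `Δ⁻¹ = Δ` and `e ∈ Δ`. -/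
structure PositivityDomain (Γ : Type*) [Group Γ] where
  carrier : Set Γ
  inv_eq : carrier⁻¹ = carrier
  one_mem : (1 : Γ) ∈ carrier

namespace PositivityDomain

variable {Γ Γ' : Type*} [Group Γ] [Group Γ']

/-- The cartesian product `Δ × Δ'` as a positivity domain in `Γ × Γ'`. -/
def prod (Δ : PositivityDomain Γ) (Δ' : PositivityDomain Γ') : PositivityDomain (Γ × Γ') where
  carrier := Δ.carrier ×ˢ Δ'.carrier
  inv_eq := by rw [Set.inv_prod, Δ.inv_eq, Δ'.inv_eq]
  one_mem := ⟨Δ.one_mem, Δ'.one_mem⟩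

/-- `Q_n(Σ) ⊆ M_n(ℂ[Γ])`: the finite sums `∑ i, y_i y_i*` with `y_i ∈ M_n(ℂ[Γ])` supported on `Σ`,
that is, `y_i = ∑ s ∈ Σ, A_s ⊗ δ_s` with `A_s ∈ M_n`. -/
def sosCone (S : Finset Γ) (n : ℕ) : Set (Matrix (Fin n) (Fin n) (MonoidAlgebra ℂ Γ)) :=
  {x | ∃ (r : ℕ) (y : Fin r → Matrix (Fin n) (Fin n) (MonoidAlgebra ℂ Γ)),
    (∀ i a b, y i a b ∈ MonoidAlgebra.supported ℂ ℂ (S : Set Γ)) ∧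
    x = ∑ i, y i * (y i).conjTranspose}

/-- `S[Δ] = span {δ_s | s ∈ Δ}`, the elements of `ℂ[Γ]` supported on `Δ`. -/
abbrev space (Δ : PositivityDomain Γ) : Submodule ℂ (MonoidAlgebra ℂ Γ) :=
  MonoidAlgebra.supported ℂ ℂ Δ.carrier

theorem star_mem_space (Δ : PositivityDomain Γ) {f : MonoidAlgebra ℂ Γ} (hf : f ∈ Δ.space) :
    star f ∈ Δ.space := by
  rw [MonoidAlgebra.mem_supported'] at hf ⊢
  intro s hs
  rw [MonoidAlgebra.star_coeff_apply, hf s⁻¹, star_zero]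
  rwa [← Set.mem_inv, Δ.inv_eq]

instance instStarSpace (Δ : PositivityDomain Γ) : StarAddMonoid Δ.space where
  star f := ⟨star f.1, Δ.star_mem_space f.2⟩
  star_involutive f := Subtype.ext (star_star f.1)
  star_add f g := Subtype.ext (star_add f.1 g.1)

instance instStarModuleSpace (Δ : PositivityDomain Γ) : StarModule ℂ Δ.space where
  star_smul c f := Subtype.ext (star_smul c f.1)

theorem single_mem_space (Δ : PositivityDomain Γ) {s : Γ} (hs : s ∈ Δ.carrier) :
    MonoidAlgebra.single s (1 : ℂ) ∈ Δ.space := by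
  classical
  rw [MonoidAlgebra.mem_supported']
  intro t ht
  have h : s ≠ t := fun h => ht (h ▸ hs)
  simp [MonoidAlgebra.coeff_single, h]

/-- The basis element `δ_s ∈ S[Δ]`, for `s ∈ Δ`. -/
def delta (Δ : PositivityDomain Γ) (s : Δ.carrier) : Δ.space :=
  ⟨MonoidAlgebra.single (s : Γ) 1, Δ.single_mem_space s.2⟩

/-- `UOS₀(Δ) = (S[Δ], (U_n(Δ))_n, δ_e)`, where `U_n(Δ)` is the convex cone generated by the union
of the cones `Q_n(Σ)` over all finite `Σ ⊆ Γ` with `Σ Σ⁻¹ ⊆ Δ`. -/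
def uosZero (Δ : PositivityDomain Γ) : MatrixConeSpace where
  carrier := Δ.space
  pos n := {x | x.map Subtype.val ∈
    PointedCone.hull ℝ
      (⋃ (S : Finset Γ) (_ : (S : Set Γ) * (S : Set Γ)⁻¹ ⊆ Δ.carrier), sosCone S n)}
  unit := Δ.delta ⟨1, Δ.one_mem⟩

/-- `UOS(Δ)`, the Archimedeanisation of `UOS₀(Δ)`. -/
def uos (Δ : PositivityDomain Γ) : MatrixConeSpace := Δ.uosZero.arch

/-- The image of `δ_s` in `UOS(Δ)`, for `s ∈ Δ`. -/
def uosDelta (Δ : PositivityDomain Γ) (s : Δ.carrier) : Δ.uos.carrier :=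
  Δ.uosZero.stateKernel.mkQ (Δ.delta s)

end PositivityDomain

end

noncomputable section

/-! ### Group algebras: supports, the external product and the canonical trace. -/

namespace MonoidAlgebra

variable {Γ Γ' : Type*} [Group Γ] [Group Γ']

/-! Both systems are realised on the same concrete space, the elements of `ℂ[Γ × Γ']` supported on
`Δ × Δ'`, through `δ_s ⊗ δ_t ↦ δ_{(s,t)}`. This is possible because vector states of the regular
representation separate the points of `S[Δ]`, so Archimedeanisation divides out nothing
(`stateKernel_uosZero`). Positivity on either side then turns out to be membership in one set, the
Archimedean closure `archCone` of the cone generated by the rank-one squares `v v*` (`mem_uos_pos`,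
`mem_maxTensor_pos`).

From the tensor product to `Δ × Δ'`: the Kronecker product of `v v*` and `w w*` is again a rank-one
square, and supports in `S` and `T` give support in `S × T`, whose difference set is the product of
the two difference sets. Passing to Archimedean closures in both factors creates cross terms, which
the order unit absorbs (`conjugate_boxKronecker_mem_archCone`).

From `Δ × Δ'` to the tensor product: let `v` be supported on `S ⊆ Γ × Γ'`, with coordinate
projections `S₁` and `S₂`. Then `v` is a scalar matrix `A` applied to the column of all `δ_s ⊠ δ_t`
with `s ∈ S₁`, `t ∈ S₂`, so `v v* = A (x ⊠ y) A*` for the rank-one squares `x`, `y` of the columns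
`(δ_s)` and `(δ_t)`. The projections remain admissible because the difference set of `S` lies in a
product set. Block sums handle finite sums (`exists_eq_conjugate_boxKronecker`). -/

theorem eq_sum_single {M : Type*} {T : Finset M} {f : MonoidAlgebra ℂ M}
    (hf : f ∈ supported ℂ ℂ (T : Set M)) : f = ∑ g ∈ T, single g (f.coeff g) := by
  conv_lhs => rw [← sum_coeff_single f]
  exact Finsupp.sum_of_support_subset _ (by exact_mod_cast mem_supported.1 hf) _ (by simp)

theorem single_mem_supported {M : Type*} {A : Set M} {s : M} (hs : s ∈ A) (c : ℂ) :
    (single s c : MonoidAlgebra ℂ M) ∈ supported ℂ ℂ A := by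
  classical
  rw [mem_supported']
  intro t ht
  have h : s ≠ t := fun h => ht (h ▸ hs)
  simp [coeff_single, h]

theorem mul_mem_supported {A B C : Set Γ} (h : A * B ⊆ C) {f g : MonoidAlgebra ℂ Γ}
    (hf : f ∈ supported ℂ ℂ A) (hg : g ∈ supported ℂ ℂ B) : f * g ∈ supported ℂ ℂ C := by
  classical
  have hf' : f ∈ supported ℂ ℂ (f.coeff.support : Set Γ) := mem_supported.2 subset_rfl
  have hg' : g ∈ supported ℂ ℂ (g.coeff.support : Set Γ) := mem_supported.2 subset_rfl
  rw [eq_sum_single hf', eq_sum_single hg', Finset.sum_mul_sum]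
  refine Submodule.sum_mem _ fun s hs => Submodule.sum_mem _ fun t ht => ?_
  rw [single_mul_single]
  exact single_mem_supported (h (Set.mul_mem_mul (hf hs) (hg ht))) _

theorem star_mem_supported {A : Set Γ} {f : MonoidAlgebra ℂ Γ}
    (hf : f ∈ supported ℂ ℂ A) : star f ∈ supported ℂ ℂ A⁻¹ := by
  rw [mem_supported'] at hf ⊢
  intro s hs
  rw [star_coeff_apply, hf s⁻¹ (by simpa using hs), star_zero]

/-- The external product `ℂ[Γ] × ℂ[Γ'] → ℂ[Γ × Γ']`, with `δ_s ⊠ δ_t = δ_{(s,t)}`. -/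
def box : MonoidAlgebra ℂ Γ →ₗ[ℂ] MonoidAlgebra ℂ Γ' →ₗ[ℂ] MonoidAlgebra ℂ (Γ × Γ') :=
  (LinearMap.mul ℂ (MonoidAlgebra ℂ (Γ × Γ'))).compl₁₂
    (mapDomainAlgHom ℂ ℂ (MonoidHom.inl Γ Γ')).toLinearMap
    (mapDomainAlgHom ℂ ℂ (MonoidHom.inr Γ Γ')).toLinearMap

theorem box_single (s : Γ) (t : Γ') (c d : ℂ) :
    box (single s c) (single t d) = single (s, t) (c * d) := by
  simp [box, mapDomain_single]

theorem box_one_one : box (1 : MonoidAlgebra ℂ Γ) (1 : MonoidAlgebra ℂ Γ') = 1 := by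
  simp [one_def, box_single, Prod.one_eq_mk]

theorem box_mul (a b : MonoidAlgebra ℂ Γ) (c d : MonoidAlgebra ℂ Γ') :
    box (a * b) (c * d) = box a c * box b d := by
  induction a using induction_linear with
  | zero => simp
  | add a₁ a₂ h₁ h₂ => simp only [add_mul, map_add, LinearMap.add_apply, h₁, h₂]
  | single s a =>
  induction b using induction_linear with
  | zero => simp
  | add a₁ a₂ h₁ h₂ => simp only [mul_add, map_add, LinearMap.add_apply, h₁, h₂]
  | single s' b =>
  induction c using induction_linear with
  | zero => simp
  | add a₁ a₂ h₁ h₂ => simp only [add_mul, map_add, h₁, h₂]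
  | single t c =>
  induction d using induction_linear with
  | zero => simp
  | add a₁ a₂ h₁ h₂ => simp only [mul_add, map_add, h₁, h₂]
  | single t' d =>
    simp only [single_mul_single, box_single, Prod.mk_mul_mk]
    congr 1; ring

theorem star_box (a : MonoidAlgebra ℂ Γ) (b : MonoidAlgebra ℂ Γ') :
    star (box a b) = box (star a) (star b) := by
  induction a using induction_linear with
  | zero => simp
  | add a₁ a₂ h₁ h₂ => simp only [map_add, LinearMap.add_apply, star_add, h₁, h₂]
  | single s a =>
  induction b using induction_linear with
  | zero => simp
  | add a₁ a₂ h₁ h₂ => simp only [map_add, star_add, h₁, h₂]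
  | single t b => simp [star_single, box_single]

theorem box_mem_supported {A : Set Γ} {B : Set Γ'} {a : MonoidAlgebra ℂ Γ}
    {b : MonoidAlgebra ℂ Γ'} (ha : a ∈ supported ℂ ℂ A) (hb : b ∈ supported ℂ ℂ B) :
    box a b ∈ supported ℂ ℂ (A ×ˢ B) := by
  have ha' : a ∈ supported ℂ ℂ (a.coeff.support : Set Γ) := mem_supported.2 subset_rfl
  have hb' : b ∈ supported ℂ ℂ (b.coeff.support : Set Γ') := mem_supported.2 subset_rfl
  rw [eq_sum_single ha', eq_sum_single hb']
  simp only [map_sum, LinearMap.sum_apply, box_single]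
  exact Submodule.sum_mem _ fun s hs => Submodule.sum_mem _ fun t ht =>
    single_mem_supported (Set.mk_mem_prod (ha ‹_›) (hb ‹_›)) _

/-- The linearisation `ℂ[Γ] ⊗ ℂ[Γ'] → ℂ[Γ × Γ']` of the external product is injective. -/
theorem lift_box_injective : Function.Injective
    (TensorProduct.lift (box : MonoidAlgebra ℂ Γ →ₗ[ℂ] MonoidAlgebra ℂ Γ' →ₗ[ℂ] _)) := by
  classical
  let e : MonoidAlgebra ℂ Γ ⊗[ℂ] MonoidAlgebra ℂ Γ' ≃ₗ[ℂ] MonoidAlgebra ℂ (Γ × Γ') :=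
    (TensorProduct.congr (coeffLinearEquiv ℂ) (coeffLinearEquiv ℂ)).trans
      ((finsuppTensorFinsupp' ℂ Γ Γ').trans (coeffLinearEquiv ℂ).symm)
  have h : TensorProduct.lift box = e.toLinearMap := by
    refine TensorProduct.ext' fun a b => ?_
    induction a using induction_linear with
    | zero => simp
    | add a₁ a₂ h₁ h₂ => simp only [TensorProduct.add_tmul, map_add, h₁, h₂]
    | single s a =>
    induction b using induction_linear with
    | zero => simp
    | add a₁ a₂ h₁ h₂ => simp only [TensorProduct.tmul_add, map_add, h₁, h₂]
    | single t b =>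
      simp only [TensorProduct.lift.tmul, box_single]
      change _ = (coeffLinearEquiv ℂ).symm (finsuppTensorFinsupp' ℂ Γ Γ'
        ((Finsupp.single s a) ⊗ₜ[ℂ] (Finsupp.single t b)))
      rw [finsuppTensorFinsupp'_single_tmul_single]
      rfl
  rw [h]
  exact e.injective

/-- The coefficient at the identity is the canonical trace, and on `g g*` it equals `∑ |g_s|²`. -/
theorem coeff_one_mul_star_self (g : MonoidAlgebra ℂ Γ) :
    ∃ r : ℝ, 0 ≤ r ∧ (g * star g).coeff 1 = r := by
  classical
  refine ⟨∑ s ∈ g.coeff.support, ‖g.coeff s‖ ^ 2, by positivity, ?_⟩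
  have hg' : g ∈ supported ℂ ℂ (g.coeff.support : Set Γ) := mem_supported.2 subset_rfl
  have h : star g = ∑ t ∈ g.coeff.support, single t⁻¹ (star (g.coeff t)) := by
    conv_lhs => rw [eq_sum_single hg']
    simp only [star_sum, star_single]
  conv_lhs => rw [h]
  conv_lhs => arg 1; arg 1; arg 1; rw [eq_sum_single hg']
  rw [Finset.sum_mul_sum]
  simp only [single_mul_single, coeff_sum, Finsupp.coe_finsetSum, Finset.sum_apply,
    coeff_single, Finsupp.single_apply, mul_inv_eq_one]
  push_cast
  refine Finset.sum_congr rfl fun s hs => ?_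
  rw [Finset.sum_ite_eq, if_pos hs]
  exact Complex.mul_conj' _

end MonoidAlgebra

open MonoidAlgebra MatrixConeSpace

/-! ### The cones generated by rank-one squares. -/

namespace PositivityDomain

variable {Γ Γ' : Type*} [Group Γ] [Group Γ'] {ι κ : Type*}

/-- The cone generated by the rank-one matrices `v v*`, for column vectors `v` with entries
supported on a finite set `S` with `S S⁻¹ ⊆ Δ`. -/
def columnCone (Δ : PositivityDomain Γ) (ι : Type*) :
    PointedCone ℝ (Matrix ι ι (MonoidAlgebra ℂ Γ)) :=
  PointedCone.hull ℝ {x | ∃ S : Finset Γ, (S : Set Γ) * (S : Set Γ)⁻¹ ⊆ Δ.carrier ∧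
    ∃ v : ι → MonoidAlgebra ℂ Γ, (∀ i, v i ∈ supported ℂ ℂ (S : Set Γ)) ∧
      x = Matrix.vecMulVec v (star v)}

variable {Δ : PositivityDomain Γ} {Δ' : PositivityDomain Γ'}

theorem vecMulVec_mem_columnCone {S : Finset Γ} (hS : (S : Set Γ) * (S : Set Γ)⁻¹ ⊆ Δ.carrier)
    {v : ι → MonoidAlgebra ℂ Γ} (hv : ∀ i, v i ∈ supported ℂ ℂ (S : Set Γ)) :
    Matrix.vecMulVec v (star v) ∈ columnCone Δ ι :=
  PointedCone.subset_hull ⟨S, hS, v, hv, rfl⟩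

theorem nnreal_smul_eq (c : {c : ℝ // 0 ≤ c}) (x : Matrix ι ι (MonoidAlgebra ℂ Γ)) :
    c • x = ((c : ℝ) : ℂ) • x := by
  ext i j s
  change (c : ℝ) • (x i j).coeff s = ((c : ℝ) : ℂ) • (x i j).coeff s
  exact Complex.real_smul

theorem smul_mem_columnCone {c : ℝ} (hc : 0 ≤ c) {x : Matrix ι ι (MonoidAlgebra ℂ Γ)}
    (hx : x ∈ columnCone Δ ι) : (c : ℂ) • x ∈ columnCone Δ ι := by
  have h := Submodule.smul_mem (columnCone Δ ι) (⟨c, hc⟩ : {c : ℝ // 0 ≤ c}) hx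
  rwa [nnreal_smul_eq] at h

@[elab_as_elim]
theorem columnCone_induction
    {P : (x : Matrix ι ι (MonoidAlgebra ℂ Γ)) → x ∈ columnCone Δ ι → Prop}
    (gen : ∀ (S : Finset Γ) (hS : (S : Set Γ) * (S : Set Γ)⁻¹ ⊆ Δ.carrier)
      (v : ι → MonoidAlgebra ℂ Γ) (hv : ∀ i, v i ∈ supported ℂ ℂ (S : Set Γ)),
        P (Matrix.vecMulVec v (star v)) (vecMulVec_mem_columnCone hS hv))
    (zero : P 0 (Submodule.zero_mem _))
    (add : ∀ x y hx hy, P x hx → P y hy → P (x + y) (Submodule.add_mem _ hx hy))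
    (smul : ∀ (c : ℝ) x hc hx, P x hx → P ((c : ℂ) • x) (smul_mem_columnCone hc hx))
    {x : Matrix ι ι (MonoidAlgebra ℂ Γ)} (hx : x ∈ columnCone Δ ι) : P x hx := by
  refine Submodule.span_induction ?_ zero (fun x y hx hy => add x y hx hy) ?_ hx
  · rintro _ ⟨S, hS, v, hv, rfl⟩
    exact gen S hS v hv
  · rintro ⟨c, hc⟩ x hx h
    simpa only [nnreal_smul_eq] using smul c x hc hx h

/-- A square `y y*` is the sum of `v v*` over the columns `v` of `y`; conversely `v v* = y y*` when
`y` has `v` as its first column and zeros elsewhere. Columns, unlike square matrices, can be handled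
over arbitrary index types. -/
theorem hull_sosCone_eq_columnCone (Δ : PositivityDomain Γ) (n : ℕ) :
    PointedCone.hull ℝ
      (⋃ (S : Finset Γ) (_ : (S : Set Γ) * (S : Set Γ)⁻¹ ⊆ Δ.carrier), sosCone S n) =
    columnCone Δ (Fin n) := by
  apply le_antisymm
  · refine Submodule.span_le.2 ?_
    intro x hx
    simp only [Set.mem_iUnion] at hx
    obtain ⟨S, hS, r, y, hy, rfl⟩ := hx
    refine Submodule.sum_mem _ fun i _ => ?_
    have h : y i * (y i).conjTranspose =
        ∑ m, Matrix.vecMulVec (fun a => y i a m) (star fun a => y i a m) := by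
      ext1 a b
      simp [Matrix.mul_apply, Matrix.sum_apply, Matrix.vecMulVec_apply]
    rw [h]
    exact Submodule.sum_mem _ fun m _ => vecMulVec_mem_columnCone hS fun a => hy i a m
  · refine Submodule.span_le.2 ?_
    rintro _ ⟨S, hS, v, hv, rfl⟩
    -- For `n = 0` there is no first column to hold `v`, but the only matrix is zero.
    rcases n with _ | n
    · rw [Subsingleton.elim (Matrix.vecMulVec v (star v)) 0]
      exact Submodule.zero_mem _
    · refine PointedCone.subset_hull ?_
      simp only [Set.mem_iUnion]
      refine ⟨S, hS, 1, fun _ => Matrix.of fun a b => if b = 0 then v a else 0, ?_, ?_⟩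
      · intro _ a b
        simp only [Matrix.of_apply]
        split_ifs
        exacts [hv a, Submodule.zero_mem _]
      · ext1 a b
        simp [Matrix.mul_apply, Matrix.vecMulVec_apply, apply_ite star]

theorem mem_uosZero_pos {n : ℕ} {x : Matrix (Fin n) (Fin n) Δ.uosZero.carrier} :
    x ∈ Δ.uosZero.pos n ↔ x.map Subtype.val ∈ columnCone Δ (Fin n) := by
  rw [← hull_sosCone_eq_columnCone]
  rfl

theorem apply_mem_space_of_mem_columnCone {x : Matrix ι ι (MonoidAlgebra ℂ Γ)}
    (hx : x ∈ columnCone Δ ι) (i j : ι) : x i j ∈ Δ.space := by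
  induction hx using columnCone_induction with
  | gen S hS v hv =>
    exact mul_mem_supported hS (hv i) (star_mem_supported (hv j))
  | zero => exact Submodule.zero_mem _
  | add x y _ _ hx hy => exact Submodule.add_mem _ hx hy
  | smul c x hc _ hx => exact Submodule.smul_mem _ _ hx

theorem conjTranspose_eq_of_mem_columnCone {x : Matrix ι ι (MonoidAlgebra ℂ Γ)}
    (hx : x ∈ columnCone Δ ι) : x.conjTranspose = x := by
  induction hx using columnCone_induction with
  | gen S hS v hv => rw [Matrix.conjTranspose_vecMulVec, star_star]
  | zero => exact Matrix.conjTranspose_zero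
  | add x y _ _ hx hy => rw [Matrix.conjTranspose_add, hx, hy]
  | smul c x hc _ hx =>
    ext1 i j
    rw [Matrix.conjTranspose_smul, hx]
    simp

theorem submatrix_mem_columnCone {x : Matrix ι ι (MonoidAlgebra ℂ Γ)}
    (hx : x ∈ columnCone Δ ι) (f : κ → ι) : x.submatrix f f ∈ columnCone Δ κ := by
  induction hx using columnCone_induction with
  | gen S hS v hv => exact vecMulVec_mem_columnCone hS fun i => hv (f i)
  | zero => exact Submodule.zero_mem _
  | add x y _ _ hx hy => exact Submodule.add_mem _ hx hy
  | smul c x hc _ hx => exact smul_mem_columnCone hc hx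

/-- Padding a column with zeros does not enlarge its support, so each diagonal block can be treated
separately. -/
theorem fromBlocks_mem_columnCone {x : Matrix ι ι (MonoidAlgebra ℂ Γ)}
    {y : Matrix κ κ (MonoidAlgebra ℂ Γ)} (hx : x ∈ columnCone Δ ι) (hy : y ∈ columnCone Δ κ) :
    Matrix.fromBlocks x 0 0 y ∈ columnCone Δ (ι ⊕ κ) := by
  have h₁ : Matrix.fromBlocks x 0 0 (0 : Matrix κ κ _) ∈ columnCone Δ (ι ⊕ κ) := by
    induction hx using columnCone_induction with
    | gen S hS v hv =>
      convert vecMulVec_mem_columnCone (v := Sum.elim v 0) hS ?_ using 1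
      · ext1 (i | i) (j | j) <;> simp [Matrix.vecMulVec_apply]
      · rintro (i | i)
        exacts [hv i, Submodule.zero_mem _]
    | zero => rw [Matrix.fromBlocks_zero]; exact Submodule.zero_mem _
    | add x y _ _ hx hy =>
      convert Submodule.add_mem _ hx hy using 1
      simp [Matrix.fromBlocks_add]
    | smul c x hc _ hx =>
      convert smul_mem_columnCone hc hx using 1
      simp [Matrix.fromBlocks_smul]
  have h₂ : Matrix.fromBlocks (0 : Matrix ι ι _) 0 0 y ∈ columnCone Δ (ι ⊕ κ) := by
    induction hy using columnCone_induction with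
    | gen S hS v hv =>
      convert vecMulVec_mem_columnCone (v := Sum.elim 0 v) hS ?_ using 1
      · ext1 (i | i) (j | j) <;> simp [Matrix.vecMulVec_apply]
      · rintro (i | i)
        exacts [Submodule.zero_mem _, hv i]
    | zero => rw [Matrix.fromBlocks_zero]; exact Submodule.zero_mem _
    | add x y _ _ hx hy =>
      convert Submodule.add_mem _ hx hy using 1
      simp [Matrix.fromBlocks_add]
    | smul c x hc _ hx =>
      convert smul_mem_columnCone hc hx using 1
      simp [Matrix.fromBlocks_smul]
  convert Submodule.add_mem _ h₁ h₂ using 1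
  simp [Matrix.fromBlocks_add]

end PositivityDomain

/-! ### Conjugation by scalar matrices and Kronecker products. -/

namespace MatrixConeSpace

variable {V W : Type*} [AddCommGroup V] [Module ℂ V] [AddCommGroup W] [Module ℂ W]
  {m n : Type*} [Fintype m]

theorem conjugate_add (A : Matrix n m ℂ) (x y : Matrix m m V) :
    conjugate A (x + y) = conjugate A x + conjugate A y := by
  ext1 i j
  simp [conjugate, Finset.sum_add_distrib]

theorem conjugate_zero (A : Matrix n m ℂ) : conjugate A (0 : Matrix m m V) = 0 := by
  ext1 i j
  simp [conjugate]

theorem conjugate_smul (A : Matrix n m ℂ) (c : ℂ) (x : Matrix m m V) :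
    conjugate A (c • x) = c • conjugate A x := by
  ext1 i j
  simp [conjugate, Finset.smul_sum, smul_comm c]

theorem conjugate_map (A : Matrix n m ℂ) (x : Matrix m m V) (f : V →ₗ[ℂ] W) :
    (conjugate A x).map f = conjugate A (x.map f) := by
  ext1 i j
  simp [conjugate]

theorem conjugate_submatrix {m' : Type*} [Fintype m'] (e : m' ≃ m) (A : Matrix n m ℂ)
    (x : Matrix m m V) :
    conjugate (A.submatrix id e) (x.submatrix e e) = conjugate A x := by
  ext1 i j
  simp only [conjugate, Matrix.of_apply, Matrix.submatrix_apply, id]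
  exact Fintype.sum_equiv e _ _ fun p => Fintype.sum_equiv e _ _ fun q => rfl

section GroupAlgebra

variable {Γ : Type*} [Group Γ]

/-- This is `A (v v*) A* = (A v)(A v)*`; since `A` is scalar, `A v` has entries supported where
those of `v` are. -/
theorem conjugate_vecMulVec (A : Matrix n m ℂ) (v : m → MonoidAlgebra ℂ Γ) :
    conjugate A (Matrix.vecMulVec v (star v)) =
      Matrix.vecMulVec (fun i => ∑ p, A i p • v p) (star fun i => ∑ p, A i p • v p) := by
  ext1 i j
  simp only [conjugate, Matrix.of_apply, Matrix.vecMulVec_apply, Pi.star_apply, star_sum,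
    star_smul, Finset.sum_mul_sum, smul_mul_smul_comm]

theorem conjTranspose_conjugate (A : Matrix n m ℂ) (x : Matrix m m (MonoidAlgebra ℂ Γ)) :
    (conjugate A x).conjTranspose = conjugate A x.conjTranspose := by
  ext1 i j
  simp only [conjugate, Matrix.of_apply, Matrix.conjTranspose_apply, star_sum, star_smul,
    star_mul', star_star]
  rw [Finset.sum_comm]
  simp only [mul_comm]

end GroupAlgebra

end MatrixConeSpace

namespace PositivityDomain

variable {Γ Γ' : Type*} [Group Γ] [Group Γ'] {ι κ : Type*}
variable {Δ : PositivityDomain Γ} {Δ' : PositivityDomain Γ'}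

theorem conjugate_mem_columnCone [Fintype ι] (A : Matrix κ ι ℂ)
    {x : Matrix ι ι (MonoidAlgebra ℂ Γ)} (hx : x ∈ columnCone Δ ι) :
    conjugate A x ∈ columnCone Δ κ := by
  induction hx using columnCone_induction with
  | gen S hS v hv =>
    rw [conjugate_vecMulVec]
    exact vecMulVec_mem_columnCone hS fun i =>
      Submodule.sum_mem _ fun p _ => Submodule.smul_mem _ _ (hv p)
  | zero => rw [conjugate_zero]; exact Submodule.zero_mem _
  | add x y _ _ hx hy => rw [conjugate_add]; exact Submodule.add_mem _ hx hy
  | smul c x hc _ hx => rw [conjugate_smul]; exact smul_mem_columnCone hc hx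

/-- The Kronecker product of matrices over `ℂ[Γ]` and `ℂ[Γ']`, with entries in `ℂ[Γ × Γ']`. -/
def boxKronecker (x : Matrix ι ι (MonoidAlgebra ℂ Γ)) (y : Matrix κ κ (MonoidAlgebra ℂ Γ')) :
    Matrix (ι × κ) (ι × κ) (MonoidAlgebra ℂ (Γ × Γ')) :=
  Matrix.kroneckerMapBilinear box x y

theorem boxKronecker_apply (x : Matrix ι ι (MonoidAlgebra ℂ Γ))
    (y : Matrix κ κ (MonoidAlgebra ℂ Γ')) (p q : ι × κ) :
    boxKronecker x y p q = box (x p.1 q.1) (y p.2 q.2) := rfl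

theorem boxKronecker_add_left (x₁ x₂ : Matrix ι ι (MonoidAlgebra ℂ Γ))
    (y : Matrix κ κ (MonoidAlgebra ℂ Γ')) :
    boxKronecker (x₁ + x₂) y = boxKronecker x₁ y + boxKronecker x₂ y := by simp [boxKronecker]

theorem boxKronecker_add_right (x : Matrix ι ι (MonoidAlgebra ℂ Γ))
    (y₁ y₂ : Matrix κ κ (MonoidAlgebra ℂ Γ')) :
    boxKronecker x (y₁ + y₂) = boxKronecker x y₁ + boxKronecker x y₂ :=
  map_add (Matrix.kroneckerMapBilinear box x) y₁ y₂

theorem boxKronecker_smul_left (c : ℂ) (x : Matrix ι ι (MonoidAlgebra ℂ Γ))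
    (y : Matrix κ κ (MonoidAlgebra ℂ Γ')) :
    boxKronecker (c • x) y = c • boxKronecker x y := by simp [boxKronecker]

theorem boxKronecker_smul_right (c : ℂ) (x : Matrix ι ι (MonoidAlgebra ℂ Γ))
    (y : Matrix κ κ (MonoidAlgebra ℂ Γ')) :
    boxKronecker x (c • y) = c • boxKronecker x y := by simp [boxKronecker]

theorem boxKronecker_vecMulVec (v : ι → MonoidAlgebra ℂ Γ) (w : κ → MonoidAlgebra ℂ Γ') :
    boxKronecker (Matrix.vecMulVec v (star v)) (Matrix.vecMulVec w (star w)) =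
      Matrix.vecMulVec (fun p : ι × κ => box (v p.1) (w p.2))
        (star fun p : ι × κ => box (v p.1) (w p.2)) := by
  ext1 p q
  simp only [boxKronecker_apply, Matrix.vecMulVec_apply, Pi.star_apply, box_mul, star_box]

theorem conjTranspose_boxKronecker (x : Matrix ι ι (MonoidAlgebra ℂ Γ))
    (y : Matrix κ κ (MonoidAlgebra ℂ Γ')) :
    (boxKronecker x y).conjTranspose = boxKronecker x.conjTranspose y.conjTranspose := by
  ext1 p q
  simp only [boxKronecker_apply, Matrix.conjTranspose_apply, star_box]

/-- Bilinearity reduces to generators, where the product is the square of the column `v ⊠ w`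
supported on `S × T`, and `(S × T)(S × T)⁻¹ = S S⁻¹ × T T⁻¹`. -/
theorem boxKronecker_mem_columnCone {x : Matrix ι ι (MonoidAlgebra ℂ Γ)}
    {y : Matrix κ κ (MonoidAlgebra ℂ Γ')} (hx : x ∈ columnCone Δ ι) (hy : y ∈ columnCone Δ' κ) :
    boxKronecker x y ∈ columnCone (Δ.prod Δ') (ι × κ) := by
  induction hx using columnCone_induction with
  | zero => simp [boxKronecker]
  | add x y _ _ hx hy => rw [boxKronecker_add_left]; exact Submodule.add_mem _ hx hy
  | smul c x hc _ hx => rw [boxKronecker_smul_left]; exact smul_mem_columnCone hc hx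
  | gen S hS v hv =>
  induction hy using columnCone_induction with
  | zero => simp [boxKronecker]
  | add x y _ _ hx hy => rw [boxKronecker_add_right]; exact Submodule.add_mem _ hx hy
  | smul c x hc _ hx => rw [boxKronecker_smul_right]; exact smul_mem_columnCone hc hx
  | gen T hT w hw =>
    rw [boxKronecker_vecMulVec]
    refine vecMulVec_mem_columnCone (S := S ×ˢ T) ?_ fun p => ?_
    · rw [Finset.coe_product, Set.inv_prod, Set.prod_mul_prod_comm]
      exact Set.prod_mono hS hT
    · rw [Finset.coe_product]
      exact box_mem_supported (hv p.1) (hw p.2)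

end PositivityDomain

/-! ### The identity matrix as an order unit. -/

namespace PositivityDomain

variable {Γ Γ' : Type*} [Group Γ] [Group Γ'] {ι κ : Type*}
variable {Δ : PositivityDomain Γ} {Δ' : PositivityDomain Γ'}

section OrderUnit

variable [DecidableEq ι]

theorem single_one_mem_columnCone (Δ : PositivityDomain Γ) (i : ι) :
    Matrix.single i i (1 : MonoidAlgebra ℂ Γ) ∈ columnCone Δ ι := by
  have h : Matrix.single i i (1 : MonoidAlgebra ℂ Γ) =
      Matrix.vecMulVec (Pi.single i 1) (star (Pi.single i 1)) := by
    rw [Matrix.single_eq_single_vecMulVec_single, Pi.star_single, star_one]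
  rw [h]
  refine vecMulVec_mem_columnCone (S := {1}) (by simpa using Δ.one_mem) fun j => ?_
  rw [Pi.single_apply]
  split_ifs
  exacts [single_mem_supported (by simp) _, Submodule.zero_mem _]

variable [Fintype ι]

theorem one_sub_single_mem_columnCone (Δ : PositivityDomain Γ) (i : ι) :
    1 - Matrix.single i i (1 : MonoidAlgebra ℂ Γ) ∈ columnCone Δ ι := by
  have h : (1 : Matrix ι ι (MonoidAlgebra ℂ Γ)) - Matrix.single i i 1 =
      ∑ k ∈ Finset.univ.erase i, Matrix.single k k 1 := by
    rw [sub_eq_iff_eq_add', Finset.add_sum_erase _ (fun k => Matrix.single k k 1)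
      (Finset.mem_univ i), Matrix.sum_single_one]
  rw [h]
  exact Submodule.sum_mem _ fun k _ => single_one_mem_columnCone Δ k

theorem one_mem_columnCone (Δ : PositivityDomain Γ) :
    (1 : Matrix ι ι (MonoidAlgebra ℂ Γ)) ∈ columnCone Δ ι := by
  rw [← Matrix.sum_single_one]
  exact Submodule.sum_mem _ fun k _ => single_one_mem_columnCone Δ k

/-- Expand the square of the column `c δ_s e_i + e_j`: besides the two wanted terms it yields `|c|²
E_ii + E_jj`, which is completed to `(|c|² + 1) · 1` by adding positive diagonal matrices. The
support `{s, 1}` is admissible since its difference set is `{1, s, s⁻¹}`. -/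
theorem exists_smul_one_add_single_mem (i j : ι) {s : Γ} (hs : s ∈ Δ.carrier) (c : ℂ) :
    ∃ R : ℝ, 0 ≤ R ∧ (R : ℂ) • (1 : Matrix ι ι (MonoidAlgebra ℂ Γ)) +
      (Matrix.single i j (single s c) + (Matrix.single i j (single s c)).conjTranspose) ∈
        columnCone Δ ι := by
  classical
  refine ⟨‖c‖ ^ 2 + 1, by positivity, ?_⟩
  have hs' : s⁻¹ ∈ Δ.carrier := by rwa [← Set.mem_inv, Δ.inv_eq]
  have hv := vecMulVec_mem_columnCone (Δ := Δ) (S := {s, 1})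
    (v := (Pi.single i (single s c) + Pi.single j 1 : ι → MonoidAlgebra ℂ Γ)) ?_ fun k => ?_
  · convert Submodule.add_mem _ hv (Submodule.add_mem _
      (smul_mem_columnCone (sq_nonneg ‖c‖) (one_sub_single_mem_columnCone Δ i))
      (one_sub_single_mem_columnCone Δ j)) using 1
    have h : Matrix.vecMulVec (Pi.single i (single s c) + Pi.single j 1 : ι → MonoidAlgebra ℂ Γ)
        (star (Pi.single i (single s c) + Pi.single j 1)) =
        (((‖c‖ ^ 2 : ℝ) : ℂ) • Matrix.single i i 1 + Matrix.single i j (single s c)) +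
        (Matrix.single j i (single s⁻¹ (star c)) + Matrix.single j j 1) := by
      have key : ∀ (a b : ι) (x y : MonoidAlgebra ℂ Γ),
          Matrix.vecMulVec (Pi.single a x) (Pi.single b y) = Matrix.single a b (x * y) := by
        intro a b x y
        ext1 k l
        by_cases hk : a = k <;> by_cases hl : b = l <;>
          simp [Matrix.vecMulVec_apply, hk, hl]
      rw [star_add, Pi.star_single, Pi.star_single, Matrix.add_vecMulVec, Matrix.vecMulVec_add,
        Matrix.vecMulVec_add, key, key, key, key, star_one, star_single, single_mul_single,
        mul_one, one_mul, mul_one, mul_inv_cancel, Matrix.smul_single, one_def, smul_single]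
      simp [Complex.mul_conj']
    rw [h, Matrix.conjTranspose_single, star_single]
    push_cast
    module
  · simp only [Finset.coe_insert, Finset.coe_singleton]
    rintro _ ⟨a, ha, b, hb, rfl⟩
    simp only [Set.mem_insert_iff, Set.mem_singleton_iff, Set.mem_inv] at ha hb
    rw [inv_eq_iff_eq_inv, inv_eq_one] at hb
    rcases ha with rfl | rfl <;> rcases hb with rfl | rfl <;> simp [Δ.one_mem, hs, hs']
  · refine Submodule.add_mem _ ?_ ?_ <;> rw [Pi.single_apply] <;> split_ifs
    exacts [single_mem_supported (by simp) _, Submodule.zero_mem _,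
      single_mem_supported (by simp) _, Submodule.zero_mem _]

/-- The identity matrix is an order unit for the cone `columnCone Δ ι` in `M_ι(S[Δ])`. -/
theorem exists_smul_one_add_mem_columnCone {h : Matrix ι ι (MonoidAlgebra ℂ Γ)}
    (hΔ : ∀ i j, h i j ∈ Δ.space) (hh : h.conjTranspose = h) :
    ∃ R : ℝ, 0 ≤ R ∧ (R : ℂ) • (1 : Matrix ι ι (MonoidAlgebra ℂ Γ)) + h ∈ columnCone Δ ι := by
  -- Symmetrising as `x + x*` makes the claim meaningful for single-entry matrices and additive in
  -- `x`; self-adjointness of `h` is used only at the end, through `h = (h + h*) / 2`.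
  let P : Matrix ι ι (MonoidAlgebra ℂ Γ) → Prop := fun x => ∃ R : ℝ, 0 ≤ R ∧
    (R : ℂ) • (1 : Matrix ι ι (MonoidAlgebra ℂ Γ)) + (x + x.conjTranspose) ∈ columnCone Δ ι
  have zero : P 0 := ⟨0, le_rfl, by simp⟩
  have add : ∀ x y, P x → P y → P (x + y) := by
    rintro x y ⟨R, hR, hx⟩ ⟨R', hR', hy⟩
    refine ⟨R + R', add_nonneg hR hR', ?_⟩
    convert Submodule.add_mem _ hx hy using 1
    rw [Matrix.conjTranspose_add]
    push_cast
    module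
  have hP : P h := by
    rw [Matrix.matrix_eq_sum_single h]
    refine Finset.sum_induction _ P add zero fun i _ =>
      Finset.sum_induction _ P add zero fun j _ => ?_
    have hij : h i j ∈ supported ℂ ℂ ((h i j).coeff.support : Set Γ) := mem_supported.2 subset_rfl
    have hsum : Matrix.single i j (h i j) = ∑ g ∈ (h i j).coeff.support,
        Matrix.single i j (single g ((h i j).coeff g)) := by
      conv_lhs => rw [eq_sum_single hij]
      exact map_sum (Matrix.singleAddMonoidHom i j) _ _
    rw [hsum]
    exact Finset.sum_induction _ P add zero fun g hg =>
      exists_smul_one_add_single_mem i j (hΔ i j hg) _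
  obtain ⟨R, hR, hx⟩ := hP
  refine ⟨1 / 2 * R, by positivity, ?_⟩
  convert smul_mem_columnCone (c := 1 / 2) (by norm_num) hx using 1
  rw [hh]
  push_cast
  module

end OrderUnit

/-! ### The Archimedean closure of the cones -/

/-- The Archimedean closure of `columnCone Δ ι`. -/
def archCone (Δ : PositivityDomain Γ) (ι : Type*) [DecidableEq ι] :
    Set (Matrix ι ι (MonoidAlgebra ℂ Γ)) :=
  {x | ∀ r : ℝ, 0 < r → (r : ℂ) • (1 : Matrix ι ι (MonoidAlgebra ℂ Γ)) + x ∈ columnCone Δ ι}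

theorem columnCone_subset_archCone [Fintype ι] [DecidableEq ι] {x : Matrix ι ι (MonoidAlgebra ℂ Γ)}
    (hx : x ∈ columnCone Δ ι) : x ∈ archCone Δ ι := fun _ hr =>
  Submodule.add_mem _ (smul_mem_columnCone hr.le (one_mem_columnCone Δ)) hx

theorem apply_mem_space_of_mem_archCone [DecidableEq ι] {x : Matrix ι ι (MonoidAlgebra ℂ Γ)}
    (hx : x ∈ archCone Δ ι) (i j : ι) : x i j ∈ Δ.space := by
  have h := apply_mem_space_of_mem_columnCone (hx 1 one_pos) i j
  have h1 : (1 : Matrix ι ι (MonoidAlgebra ℂ Γ)) i j ∈ Δ.space := by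
    rw [Matrix.one_apply]
    split_ifs
    exacts [Δ.single_mem_space Δ.one_mem, Submodule.zero_mem _]
  simpa using Submodule.sub_mem _ h h1

theorem conjTranspose_eq_of_mem_archCone [DecidableEq ι] {x : Matrix ι ι (MonoidAlgebra ℂ Γ)}
    (hx : x ∈ archCone Δ ι) : x.conjTranspose = x := by
  simpa using conjTranspose_eq_of_mem_columnCone (hx 1 one_pos)

theorem one_mem_archCone [Fintype ι] [DecidableEq ι] (Δ : PositivityDomain Γ) :
    (1 : Matrix ι ι (MonoidAlgebra ℂ Γ)) ∈ archCone Δ ι :=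
  columnCone_subset_archCone (one_mem_columnCone Δ)

/-- Conjugates of Kronecker products of elements of the Archimedean closures lie in the
Archimedean closure. -/
theorem conjugate_boxKronecker_mem_archCone [Fintype ι] [Fintype κ] [DecidableEq ι]
    [DecidableEq κ] {ν : Type*} [Fintype ν] [DecidableEq ν] (A : Matrix ν (ι × κ) ℂ)
    {x : Matrix ι ι (MonoidAlgebra ℂ Γ)} {y : Matrix κ κ (MonoidAlgebra ℂ Γ')}
    (hx : x ∈ archCone Δ ι) (hy : y ∈ archCone Δ' κ) :
    conjugate A (boxKronecker x y) ∈ archCone (Δ.prod Δ') ν := by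
  -- In `(ε + x) ⊠ (ε + y)` the surplus terms are `ε (1 ⊠ y)`, `ε (x ⊠ 1)` and `ε² (1 ⊠ 1)`. Their
  -- conjugates are bounded above by multiples of the order unit.
  have bound : ∀ {a : Matrix ι ι (MonoidAlgebra ℂ Γ)} {b : Matrix κ κ (MonoidAlgebra ℂ Γ')},
      a ∈ archCone Δ ι → b ∈ archCone Δ' κ → ∃ R : ℝ, 0 ≤ R ∧
        (R : ℂ) • (1 : Matrix ν ν (MonoidAlgebra ℂ (Γ × Γ'))) +
          (-1 : ℂ) • conjugate A (boxKronecker a b) ∈ columnCone (Δ.prod Δ') ν := by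
    intro a b ha hb
    refine exists_smul_one_add_mem_columnCone (fun i j => ?_) ?_
    · refine Submodule.smul_mem _ _ (Submodule.sum_mem _ fun p _ => Submodule.sum_mem _ fun q _ =>
        Submodule.smul_mem _ _ ?_)
      exact box_mem_supported (apply_mem_space_of_mem_archCone ha _ _)
        (apply_mem_space_of_mem_archCone hb _ _)
    · rw [Matrix.conjTranspose_smul, conjTranspose_conjugate, conjTranspose_boxKronecker,
        conjTranspose_eq_of_mem_archCone ha, conjTranspose_eq_of_mem_archCone hb]
      simp
  obtain ⟨R₁, hR₁, h₁⟩ := bound (one_mem_archCone Δ) hy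
  obtain ⟨R₂, hR₂, h₂⟩ := bound hx (one_mem_archCone Δ')
  obtain ⟨R₃, hR₃, h₃⟩ := bound (one_mem_archCone Δ) (one_mem_archCone Δ')
  intro r hr
  -- The bound `ε ≤ 1` gives `ε² R₃ ≤ ε R₃`, so the three surplus terms together cost at most `r`.
  obtain ⟨ε, hε, hε₁, hεr⟩ : ∃ ε : ℝ, 0 < ε ∧ ε ≤ 1 ∧ ε * (R₁ + R₂ + R₃) ≤ r := by
    refine ⟨min 1 (r / (R₁ + R₂ + R₃ + 1)), by positivity, min_le_left _ _, ?_⟩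
    calc _ ≤ r / (R₁ + R₂ + R₃ + 1) * (R₁ + R₂ + R₃ + 1) :=
          mul_le_mul (min_le_right _ _) (by linarith) (by positivity) (by positivity)
      _ = r := div_mul_cancel₀ _ (by positivity)
  have hε₂ : 0 ≤ r - ε * R₁ - ε * R₂ - ε * ε * R₃ := by
    nlinarith [mul_nonneg hε.le hR₃]
  have h₀ := conjugate_mem_columnCone A (boxKronecker_mem_columnCone (hx ε hε) (hy ε hε))
  convert Submodule.add_mem _ (Submodule.add_mem _ (Submodule.add_mem _ (Submodule.add_mem _ h₀
    (smul_mem_columnCone hε.le h₁)) (smul_mem_columnCone hε.le h₂))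
    (smul_mem_columnCone (mul_nonneg hε.le hε.le) h₃))
    (smul_mem_columnCone hε₂ (one_mem_columnCone (Δ.prod Δ'))) using 1
  simp only [boxKronecker_add_left, boxKronecker_add_right, boxKronecker_smul_left,
    boxKronecker_smul_right, conjugate_add, conjugate_smul]
  push_cast
  module

/-- Every element of `columnCone (Δ.prod Δ')` is a conjugate of a Kronecker product. -/
theorem exists_eq_conjugate_boxKronecker {ν : Type*} {w : Matrix ν ν (MonoidAlgebra ℂ (Γ × Γ'))}
    (hw : w ∈ columnCone (Δ.prod Δ') ν) :
    ∃ (k l : ℕ) (x : Matrix (Fin k) (Fin k) (MonoidAlgebra ℂ Γ))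
      (y : Matrix (Fin l) (Fin l) (MonoidAlgebra ℂ Γ')) (A : Matrix ν (Fin k × Fin l) ℂ),
      x ∈ columnCone Δ (Fin k) ∧ y ∈ columnCone Δ' (Fin l) ∧
        w = conjugate A (boxKronecker x y) := by
  classical
  induction hw using columnCone_induction with
  | zero =>
    refine ⟨0, 0, 0, 0, 0, Submodule.zero_mem _, Submodule.zero_mem _, ?_⟩
    simp [boxKronecker, conjugate_zero]
  | smul c x hc _ hx =>
    obtain ⟨k, l, x, y, A, hx, hy, rfl⟩ := hx
    refine ⟨k, l, (c : ℂ) • x, y, A, smul_mem_columnCone hc hx, hy, ?_⟩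
    rw [boxKronecker_smul_left, conjugate_smul]
  | add w₁ w₂ _ _ h₁ h₂ =>
    obtain ⟨k₁, l₁, x₁, y₁, A₁, hx₁, hy₁, rfl⟩ := h₁
    obtain ⟨k₂, l₂, x₂, y₂, A₂, hx₂, hy₂, rfl⟩ := h₂
    let e := (finSumFinEquiv (m := k₁) (n := k₂)).symm
    let f := (finSumFinEquiv (m := l₁) (n := l₂)).symm
    -- The Kronecker product of the block sums also contains `x₁ ⊠ y₂` and `x₂ ⊠ y₁`; `A` vanishes
    -- on these mixed blocks and so removes them.
    let A : Matrix ν ((Fin k₁ ⊕ Fin k₂) × (Fin l₁ ⊕ Fin l₂)) ℂ := Matrix.of fun i p =>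
      Sum.elim (fun a => Sum.elim (fun b => A₁ i (a, b)) 0 p.2)
        (fun a => Sum.elim 0 (fun b => A₂ i (a, b)) p.2) p.1
    refine ⟨k₁ + k₂, l₁ + l₂, (Matrix.fromBlocks x₁ 0 0 x₂).submatrix e e,
      (Matrix.fromBlocks y₁ 0 0 y₂).submatrix f f, A.submatrix id (e.prodCongr f),
      submatrix_mem_columnCone (fromBlocks_mem_columnCone hx₁ hx₂) _,
      submatrix_mem_columnCone (fromBlocks_mem_columnCone hy₁ hy₂) _, ?_⟩
    refine Eq.trans ?_ (conjugate_submatrix (e.prodCongr f) A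
      (boxKronecker (Matrix.fromBlocks x₁ 0 0 x₂) (Matrix.fromBlocks y₁ 0 0 y₂))).symm
    ext1 i j
    simp [conjugate, boxKronecker_apply, Fintype.sum_prod_type, A]
  | gen S hS v hv =>
    -- `S` need not be a product, but `S₁ S₁⁻¹` and `S₂ S₂⁻¹` are the projections of `S S⁻¹ ⊆ Δ ×
    -- Δ'`, hence lie in `Δ` and `Δ'`.
    let S₁ := S.image Prod.fst
    let S₂ := S.image Prod.snd
    have hS₁ : (S₁ : Set Γ) * (S₁ : Set Γ)⁻¹ ⊆ Δ.carrier := by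
      rintro _ ⟨a, ha, b, hb, rfl⟩
      simp only [S₁, Finset.coe_image, Set.mem_inv, Set.mem_image] at ha hb
      obtain ⟨p, hp, rfl⟩ := ha
      obtain ⟨q, hq, hqb⟩ := hb
      have := (hS (Set.mul_mem_mul hp (Set.inv_mem_inv.2 hq))).1
      simpa [hqb] using this
    have hS₂ : (S₂ : Set Γ') * (S₂ : Set Γ')⁻¹ ⊆ Δ'.carrier := by
      rintro _ ⟨a, ha, b, hb, rfl⟩
      simp only [S₂, Finset.coe_image, Set.mem_inv, Set.mem_image] at ha hb
      obtain ⟨p, hp, rfl⟩ := ha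
      obtain ⟨q, hq, hqb⟩ := hb
      have := (hS (Set.mul_mem_mul hp (Set.inv_mem_inv.2 hq))).2
      simpa [hqb] using this
    let e := S₁.equivFin.symm
    let f := S₂.equivFin.symm
    -- All information about `v` goes into the scalar matrix of its coefficients; the two
    -- group-algebra factors depend only on `S₁` and `S₂`.
    refine ⟨S₁.card, S₂.card, _, _, Matrix.of fun i p => (v i).coeff ((e p.1 : Γ), (f p.2 : Γ')),
      vecMulVec_mem_columnCone (v := fun p => single (e p : Γ) 1) hS₁
        fun p => single_mem_supported (e p).2 _,
      vecMulVec_mem_columnCone (v := fun p => single (f p : Γ') 1) hS₂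
        fun p => single_mem_supported (f p).2 _, ?_⟩
    rw [boxKronecker_vecMulVec, conjugate_vecMulVec]
    have key : (fun i => ∑ p : Fin S₁.card × Fin S₂.card,
        (Matrix.of fun i (p : Fin S₁.card × Fin S₂.card) =>
          (v i).coeff ((e p.1 : Γ), (f p.2 : Γ'))) i p •
          box (single (e p.1 : Γ) (1 : ℂ)) (single (f p.2 : Γ') (1 : ℂ))) = v := by
      funext i
      have hvi : v i ∈ supported ℂ ℂ ((S₁ ×ˢ S₂ : Finset (Γ × Γ')) : Set (Γ × Γ')) :=
        supported_mono (by
          intro p hp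
          simp only [Finset.coe_product, Set.mem_prod, Finset.mem_coe]
          exact ⟨Finset.mem_image_of_mem _ hp, Finset.mem_image_of_mem _ hp⟩) (hv i)
      conv_rhs => rw [eq_sum_single hvi, Finset.sum_product, ← Finset.sum_coe_sort S₁]
      rw [Fintype.sum_prod_type]
      refine Fintype.sum_equiv e _ _ fun a => ?_
      rw [← Finset.sum_coe_sort S₂]
      refine Fintype.sum_equiv f _ _ fun b => ?_
      simp [box_single]
    rw [key]

end PositivityDomain

/-! ### Archimedeanisation and the comparison of cones. -/

namespace MatrixConeSpace

/-- If the states of `X` separate points, then `X` and its Archimedeanisation have the same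
underlying space. -/
theorem mem_arch_pos {X : MatrixConeSpace} (h : X.stateKernel = ⊥) {n : ℕ}
    {x : Matrix (Fin n) (Fin n) (X.carrier ⧸ X.stateKernel)} :
    x ∈ X.arch.pos n ↔ ∀ r : ℝ, 0 < r →
      (r : ℂ) • X.matrixUnit n + x.map (Submodule.quotEquivOfEqBot _ h) ∈ X.pos n := by
  refine forall_congr' fun r => forall_congr' fun _ => ?_
  have hx : ((r : ℂ) • X.matrixUnit n + x.map (Submodule.quotEquivOfEqBot _ h)).map
      X.stateKernel.mkQ = (r : ℂ) • (X.matrixUnit n).map X.stateKernel.mkQ + x := by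
    ext1 i j
    simp only [Matrix.map_apply, Matrix.add_apply, Matrix.smul_apply, map_add, map_smul]
    congr 1
    exact (Submodule.quotEquivOfEqBot _ h).symm_apply_apply (x i j)
  constructor
  · rintro ⟨y, hy, hxy⟩
    rw [← hx] at hxy
    have hinj : Function.Injective X.stateKernel.mkQ := by
      rw [← LinearMap.ker_eq_bot, Submodule.ker_mkQ, h]
    rwa [Matrix.map_injective hinj hxy]
  · exact fun hy => ⟨_, hy, hx.symm⟩

end MatrixConeSpace

namespace PositivityDomain

variable {Γ Γ' : Type*} [Group Γ] [Group Γ']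

/-! ### Vector states, and the triviality of the state kernel -/

/-- The functional `f ↦ ⟨λ(f) ξ, ξ⟩` on `ℂ[Γ]`, for `λ` the left regular representation. -/
def vectorFunctional (ξ : MonoidAlgebra ℂ Γ) : MonoidAlgebra ℂ Γ →ₗ[ℂ] ℂ :=
  Finsupp.lapply 1 ∘ₗ (coeffLinearEquiv ℂ).toLinearMap ∘ₗ LinearMap.mulLeft ℂ (star ξ) ∘ₗ
    LinearMap.mulRight ℂ ξ

theorem vectorFunctional_apply (ξ f : MonoidAlgebra ℂ Γ) :
    vectorFunctional ξ f = (star ξ * (f * ξ)).coeff 1 := rfl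

theorem vectorFunctional_star (ξ f : MonoidAlgebra ℂ Γ) :
    vectorFunctional ξ (star f) = star (vectorFunctional ξ f) := by
  have h : star ξ * (star f * ξ) = star (star ξ * (f * ξ)) := by simp [mul_assoc]
  rw [vectorFunctional_apply, h, star_coeff_apply, inv_one, vectorFunctional_apply]

/-- On a diagonal entry of `v v*` the functional is the trace of `(ξ* v_i)(ξ* v_i)*`. -/
theorem vectorFunctional_nonneg {Δ : PositivityDomain Γ} {ι : Type*} (ξ : MonoidAlgebra ℂ Γ)
    {x : Matrix ι ι (MonoidAlgebra ℂ Γ)} (hx : x ∈ columnCone Δ ι) (i : ι) :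
    ∃ r : ℝ, 0 ≤ r ∧ vectorFunctional ξ (x i i) = r := by
  induction hx using columnCone_induction with
  | zero => exact ⟨0, le_rfl, by simp⟩
  | add x y _ _ hx hy =>
    obtain ⟨a, ha, hx⟩ := hx
    obtain ⟨b, hb, hy⟩ := hy
    exact ⟨a + b, add_nonneg ha hb, by simp [hx, hy]⟩
  | smul c x hc _ hx =>
    obtain ⟨a, ha, hx⟩ := hx
    exact ⟨c * a, mul_nonneg hc ha, by simp [hx]⟩
  | gen S hS v hv =>
    obtain ⟨r, hr, h⟩ := coeff_one_mul_star_self (star ξ * v i)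
    refine ⟨r, hr, ?_⟩
    rw [← h, vectorFunctional_apply, Matrix.vecMulVec_apply, Pi.star_apply, star_mul, star_star]
    simp only [mul_assoc]

theorem isState_vectorFunctional (Δ : PositivityDomain Γ) {ξ : MonoidAlgebra ℂ Γ}
    (hξ : vectorFunctional ξ 1 = 1) :
    Δ.uosZero.IsState (vectorFunctional ξ ∘ₗ Δ.space.subtype) :=
  ⟨fun f => vectorFunctional_star ξ (f : Δ.space).1,
    fun _ hf => vectorFunctional_nonneg ξ (mem_uosZero_pos.1 hf) 0, hξ⟩

theorem vectorFunctional_single_add_single (s : Γ) (a b : ℂ) (f : MonoidAlgebra ℂ Γ) :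
    vectorFunctional (single 1 a + single s b) f =
      star a * a * f.coeff 1 + star a * b * f.coeff s⁻¹ + star b * a * f.coeff s +
        star b * b * f.coeff 1 := by
  induction f using induction_linear with
  | zero => simp
  | add f g hf hg =>
    rw [map_add, hf, hg]
    simp only [coeff_add, Finsupp.add_apply]
    ring
  | single t c =>
    classical
    have h₁ : s⁻¹ * t = 1 ↔ t = s := by rw [inv_mul_eq_one, eq_comm]
    have h₂ : t * s = 1 ↔ t = s⁻¹ := mul_eq_one_iff_eq_inv
    have h₃ : s⁻¹ * (t * s) = 1 ↔ t = 1 := by rw [inv_mul_eq_one, eq_comm, mul_eq_right]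
    simp only [vectorFunctional_apply, star_add, star_single, add_mul, mul_add, single_mul_single,
      coeff_add, Finsupp.add_apply, coeff_single, Finsupp.single_apply, inv_one, one_mul, mul_one,
      h₁, h₂, h₃, mul_ite, mul_zero]
    split_ifs <;> ring

/-- Polarisation with vector states: `ξ = δ_1` detects the coefficient at the identity, and unit
vectors in the span of `δ_1` and `δ_s` detect those at `s` and `s⁻¹`. -/
theorem stateKernel_uosZero (Δ : PositivityDomain Γ) : Δ.uosZero.stateKernel = ⊥ := by
  rw [eq_bot_iff]
  intro f hf
  rw [mem_stateKernel] at hf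
  replace hf : ∀ ξ, vectorFunctional ξ 1 = 1 → vectorFunctional ξ (f : Δ.space).1 = 0 :=
    fun ξ hξ => hf _ (Δ.isState_vectorFunctional hξ)
  have h₁ : (f : Δ.space).1.coeff 1 = 0 := by
    simpa [vectorFunctional_apply] using hf 1 (by simp [vectorFunctional_apply])
  have h5 : star (4 / 5 : ℂ) = 4 / 5 := by simp
  have h3 : star (3 / 5 : ℂ) = 3 / 5 := by simp
  have hs : ∀ s : Γ, s ≠ 1 → ∀ c : ℂ, star c * c = 1 →
      c * (f : Δ.space).1.coeff s⁻¹ + star c * (f : Δ.space).1.coeff s = 0 := by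
    intro s hs c hc
    -- The Pythagorean pair `3/5`, `4/5` gives a unit vector with rational weights; `25/12` is the
    -- inverse of their product.
    have h := hf (single 1 (3 / 5) + single s (4 / 5 * c)) ?_
    · rw [vectorFunctional_single_add_single, h₁, star_mul', h5, h3] at h
      linear_combination (25 / 12 : ℂ) * h
    · rw [vectorFunctional_single_add_single, star_mul', h5, h3, coeff_one_one, one_def,
        coeff_single, Finsupp.single_eq_of_ne hs,
        Finsupp.single_eq_of_ne (inv_ne_one.2 hs)]
      linear_combination (16 / 25 : ℂ) * hc
  refine (Submodule.mem_bot ℂ).2 (Subtype.ext ?_)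
  ext s
  change (f : Δ.space).1.coeff s = 0
  by_cases hs1 : s = 1
  · rw [hs1]; exact h₁
  -- The phases `1` and `i` give the sum and the difference of the coefficients at `s⁻¹` and `s`, so
  -- both vanish.
  · have ha := hs s hs1 1 (by simp)
    have hb := hs s hs1 Complex.I (by simp)
    simp only [star_one, one_mul, Complex.star_def, Complex.conj_I] at ha hb
    linear_combination (1 / 2 : ℂ) * ha + (Complex.I / 2) * hb +
      (-((f : Δ.space).1.coeff s⁻¹) / 2 + (f : Δ.space).1.coeff s / 2) * Complex.I_sq

/-- `UOS(Δ)` has the same underlying space as `UOS₀(Δ)`. -/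
def uosEquiv (Δ : PositivityDomain Γ) : Δ.uos.carrier ≃ₗ[ℂ] Δ.space :=
  Submodule.quotEquivOfEqBot _ Δ.stateKernel_uosZero

/-- `UOS(Δ)` as a space of functions on `Γ`. -/
def realize (Δ : PositivityDomain Γ) : Δ.uos.carrier →ₗ[ℂ] MonoidAlgebra ℂ Γ :=
  Δ.space.subtype ∘ₗ Δ.uosEquiv.toLinearMap

theorem realize_uosDelta (Δ : PositivityDomain Γ) (s : Δ.carrier) :
    Δ.realize (Δ.uosDelta s) = single (s : Γ) 1 := rfl

theorem realize_unit (Δ : PositivityDomain Γ) : Δ.realize Δ.uos.unit = 1 := rfl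

theorem realize_star (Δ : PositivityDomain Γ) (v : Δ.uos.carrier) :
    Δ.realize (star v) = star (Δ.realize v) := by
  obtain ⟨f, rfl⟩ := Δ.uosZero.stateKernel.mkQ_surjective v
  rfl

theorem realize_injective (Δ : PositivityDomain Γ) : Function.Injective Δ.realize :=
  Subtype.val_injective.comp Δ.uosEquiv.injective

theorem realize_mem_space (Δ : PositivityDomain Γ) (v : Δ.uos.carrier) :
    Δ.realize v ∈ Δ.space := (Δ.uosEquiv v).2

theorem exists_map_realize {Δ : PositivityDomain Γ} {ι : Type*}
    {x : Matrix ι ι (MonoidAlgebra ℂ Γ)} (hx : ∀ i j, x i j ∈ Δ.space) :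
    ∃ y : Matrix ι ι Δ.uos.carrier, y.map Δ.realize = x :=
  ⟨Matrix.of fun i j => Δ.uosZero.stateKernel.mkQ (⟨x i j, hx i j⟩ : Δ.space), rfl⟩

/-- With trivial state kernel the quotient disappears, and positivity can be tested inside `ℂ[Γ]`.
-/
theorem mem_uos_pos {Δ : PositivityDomain Γ} {n : ℕ} {x : Matrix (Fin n) (Fin n) Δ.uos.carrier} :
    x ∈ Δ.uos.pos n ↔ x.map Δ.realize ∈ archCone Δ (Fin n) := by
  refine (mem_arch_pos Δ.stateKernel_uosZero).trans
    (forall_congr' fun r => forall_congr' fun _ => ?_)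
  refine mem_uosZero_pos.trans (Eq.to_iff (congrArg (· ∈ columnCone Δ (Fin n)) ?_))
  ext1 i j
  change (r : ℂ) • (Δ.uosZero.matrixUnit n i j : Δ.space).1 + Δ.realize (x i j) =
    (r : ℂ) • (1 : Matrix (Fin n) (Fin n) (MonoidAlgebra ℂ Γ)) i j + Δ.realize (x i j)
  congr 2
  by_cases h : i = j
  · subst h
    rw [Matrix.one_apply_eq, matrixUnit, Matrix.diagonal_apply_eq]
    rfl
  · rw [Matrix.one_apply_ne h, matrixUnit, Matrix.diagonal_apply_ne _ h]
    rfl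

/-! ### The maximal tensor product -/

variable (Δ : PositivityDomain Γ) (Δ' : PositivityDomain Γ')

/-- `UOS(Δ) ⊗_max UOS(Δ')` as a space of functions on `Γ × Γ'`. -/
def tensorRealize : Δ.uos.carrier ⊗[ℂ] Δ'.uos.carrier →ₗ[ℂ] MonoidAlgebra ℂ (Γ × Γ') :=
  TensorProduct.lift box ∘ₗ TensorProduct.map Δ.realize Δ'.realize

theorem tensorRealize_tmul (v : Δ.uos.carrier) (w : Δ'.uos.carrier) :
    tensorRealize Δ Δ' (v ⊗ₜ[ℂ] w) = box (Δ.realize v) (Δ'.realize w) := rfl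

theorem tensorRealize_unit : tensorRealize Δ Δ' (Δ.uos.unit ⊗ₜ[ℂ] Δ'.uos.unit) = 1 :=
  box_one_one

theorem tensorRealize_star (z : Δ.uos.carrier ⊗[ℂ] Δ'.uos.carrier) :
    tensorRealize Δ Δ' (star z) = star (tensorRealize Δ Δ' z) := by
  induction z using TensorProduct.induction_on with
  | zero => simp
  | tmul v w =>
    rw [TensorProduct.star_tmul, tensorRealize_tmul, tensorRealize_tmul, realize_star,
      realize_star, star_box]
  | add x y hx hy => rw [star_add, map_add, map_add, star_add, hx, hy]

/-- Over a field, tensor products of injective maps are injective. -/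
theorem tensorRealize_injective : Function.Injective (tensorRealize Δ Δ') :=
  lift_box_injective.comp
    (TensorProduct.map_injective_of_flat_flat _ _ Δ.realize_injective Δ'.realize_injective)

theorem range_tensorRealize : LinearMap.range (tensorRealize Δ Δ') = (Δ.prod Δ').space := by
  apply le_antisymm
  · rintro _ ⟨z, rfl⟩
    induction z using TensorProduct.induction_on with
    | zero => rw [map_zero]; exact Submodule.zero_mem _
    | tmul v w => exact box_mem_supported (Δ.realize_mem_space v) (Δ'.realize_mem_space w)
    | add x y hx hy => rw [map_add]; exact Submodule.add_mem _ hx hy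
  · change supported ℂ ℂ _ ≤ _
    rw [supported_eq_span_single, Submodule.span_le]
    rintro _ ⟨⟨s, t⟩, ⟨hs, ht⟩, rfl⟩
    refine ⟨Δ.uosDelta ⟨s, hs⟩ ⊗ₜ[ℂ] Δ'.uosDelta ⟨t, ht⟩, ?_⟩
    rw [tensorRealize_tmul, realize_uosDelta, realize_uosDelta, box_single, one_mul]

theorem map_tensorRealize_conjugate {n k l : ℕ} (A : Matrix (Fin n) (Fin k × Fin l) ℂ)
    (x : Matrix (Fin k) (Fin k) Δ.uos.carrier) (y : Matrix (Fin l) (Fin l) Δ'.uos.carrier) :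
    (conjugate A (matrixTensor x y)).map (tensorRealize Δ Δ') =
      conjugate A (boxKronecker (x.map Δ.realize) (y.map Δ'.realize)) :=
  conjugate_map A (matrixTensor x y) (tensorRealize Δ Δ')

/-- The heart of the theorem: the maximal tensor cone and the cone of `UOS(Δ × Δ')` have the same
image in matrices over `ℂ[Γ × Γ']`. -/
theorem mem_maxTensor_pos {n : ℕ} {z : Matrix (Fin n) (Fin n) (Δ.uos.carrier ⊗[ℂ] Δ'.uos.carrier)} :
    z ∈ (maxTensor Δ.uos Δ'.uos).pos n ↔
      z.map (tensorRealize Δ Δ') ∈ archCone (Δ.prod Δ') (Fin n) := by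
  have hmap : ∀ r : ℝ, ((r : ℂ) • (Matrix.diagonal fun _ => Δ.uos.unit ⊗ₜ[ℂ] Δ'.uos.unit)
      + z).map (tensorRealize Δ Δ') = (r : ℂ) • 1 + z.map (tensorRealize Δ Δ') := by
    intro r
    ext1 i j
    simp only [Matrix.map_apply, Matrix.add_apply, Matrix.smul_apply, map_add, map_smul]
    congr 2
    by_cases h : i = j
    · subst h
      rw [Matrix.diagonal_apply_eq, Matrix.one_apply_eq, tensorRealize_unit]
    · rw [Matrix.diagonal_apply_ne _ h, Matrix.one_apply_ne h, map_zero]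
  constructor
  · intro hz r hr
    -- Half of `r` brings `z` into `D_n^max`; the other half is needed because `x` and `y` are
    -- positive only in the Archimedean closures.
    obtain ⟨k, l, x, y, A, hx, hy, h⟩ := hz (r / 2) (half_pos hr)
    have h' := conjugate_boxKronecker_mem_archCone A (mem_uos_pos.1 hx) (mem_uos_pos.1 hy)
      (r / 2) (half_pos hr)
    rw [← map_tensorRealize_conjugate, ← h, hmap] at h'
    convert h' using 1
    push_cast
    module
  · intro hz r hr
    -- Here `r · 1 + z` lies in the cone before closure, so it factors exactly and no splitting of
    -- `r` is needed.
    obtain ⟨k, l, x, y, A, hx, hy, h⟩ := exists_eq_conjugate_boxKronecker (hz r hr)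
    obtain ⟨x, rfl⟩ := exists_map_realize (apply_mem_space_of_mem_columnCone hx)
    obtain ⟨y, rfl⟩ := exists_map_realize (apply_mem_space_of_mem_columnCone hy)
    refine ⟨k, l, x, y, A, mem_uos_pos.2 (columnCone_subset_archCone hx),
      mem_uos_pos.2 (columnCone_subset_archCone hy), ?_⟩
    rw [← hmap, ← map_tensorRealize_conjugate] at h
    exact Matrix.map_injective (tensorRealize_injective Δ Δ') h

/-- The canonical isomorphism `UOS(Δ × Δ') ≃ UOS(Δ) ⊗_max UOS(Δ')`. -/
def uosProdEquiv : (Δ.prod Δ').uos.carrier ≃ₗ[ℂ] Δ.uos.carrier ⊗[ℂ] Δ'.uos.carrier :=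
  (Δ.prod Δ').uosEquiv ≪≫ₗ
    ((LinearEquiv.ofInjective _ (tensorRealize_injective Δ Δ')) ≪≫ₗ
      LinearEquiv.ofEq _ _ (range_tensorRealize Δ Δ')).symm

theorem realize_uosProdEquiv_symm (z : Δ.uos.carrier ⊗[ℂ] Δ'.uos.carrier) :
    (Δ.prod Δ').realize ((uosProdEquiv Δ Δ').symm z) = tensorRealize Δ Δ' z := by
  simp [realize, uosProdEquiv]

theorem tensorRealize_uosProdEquiv (v : (Δ.prod Δ').uos.carrier) :
    tensorRealize Δ Δ' (uosProdEquiv Δ Δ' v) = (Δ.prod Δ').realize v := by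
  rw [← realize_uosProdEquiv_symm, LinearEquiv.symm_apply_apply]

theorem uosProdEquiv_star (v : (Δ.prod Δ').uos.carrier) :
    uosProdEquiv Δ Δ' (star v) = star (uosProdEquiv Δ Δ' v) := by
  apply tensorRealize_injective Δ Δ'
  rw [tensorRealize_star, tensorRealize_uosProdEquiv, tensorRealize_uosProdEquiv, realize_star]

theorem map_uosProdEquiv_mem_pos {n : ℕ} {x : Matrix (Fin n) (Fin n) (Δ.prod Δ').uos.carrier}
    (hx : x ∈ (Δ.prod Δ').uos.pos n) :
    x.map (uosProdEquiv Δ Δ') ∈ (maxTensor Δ.uos Δ'.uos).pos n := by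
  refine (mem_maxTensor_pos Δ Δ').2 ?_
  rw [Matrix.map_map, show tensorRealize Δ Δ' ∘ uosProdEquiv Δ Δ' = (Δ.prod Δ').realize from
    funext (tensorRealize_uosProdEquiv Δ Δ')]
  exact mem_uos_pos.1 hx

theorem map_uosProdEquiv_symm_mem_pos {n : ℕ}
    {z : Matrix (Fin n) (Fin n) (Δ.uos.carrier ⊗[ℂ] Δ'.uos.carrier)}
    (hz : z ∈ (maxTensor Δ.uos Δ'.uos).pos n) :
    z.map (uosProdEquiv Δ Δ').symm ∈ (Δ.prod Δ').uos.pos n := by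
  refine mem_uos_pos.2 ?_
  rw [Matrix.map_map, show (Δ.prod Δ').realize ∘ (uosProdEquiv Δ Δ').symm = tensorRealize Δ Δ' from
    funext (realize_uosProdEquiv_symm Δ Δ')]
  exact (mem_maxTensor_pos Δ Δ').1 hz

theorem uosProdEquiv_unit :
    uosProdEquiv Δ Δ' (Δ.prod Δ').uos.unit = Δ.uos.unit ⊗ₜ[ℂ] Δ'.uos.unit := by
  apply tensorRealize_injective Δ Δ'
  rw [tensorRealize_uosProdEquiv, tensorRealize_unit, realize_unit]

theorem uosProdEquiv_uosDelta (s : Δ.carrier) (t : Δ'.carrier) :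
    uosProdEquiv Δ Δ' ((Δ.prod Δ').uosDelta ⟨(s.1, t.1), ⟨s.2, t.2⟩⟩) =
      Δ.uosDelta s ⊗ₜ[ℂ] Δ'.uosDelta t := by
  apply tensorRealize_injective Δ Δ'
  rw [tensorRealize_uosProdEquiv, tensorRealize_tmul, realize_uosDelta, realize_uosDelta,
    realize_uosDelta, box_single, one_mul]

end PositivityDomain

end

theorem mainTheorem4 {Γ : Type*} {Γ' : Type*} [Group Γ] [Group Γ']
    (Δ : PositivityDomain Γ) (Δ' : PositivityDomain Γ') :
    ∃ φ : (Δ.prod Δ').uos.carrier ≃ₗ[ℂ] (MatrixConeSpace.maxTensor Δ.uos Δ'.uos).carrier,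
      MatrixConeSpace.IsCompleteOrderIso φ ∧
      φ (Δ.prod Δ').uos.unit = (MatrixConeSpace.maxTensor Δ.uos Δ'.uos).unit ∧
      ∀ (s : Δ.carrier) (t : Δ'.carrier),
        φ ((Δ.prod Δ').uosDelta ⟨(s.1, t.1), ⟨s.2, t.2⟩⟩) =
          MatrixConeSpace.maxTensor.tmul (Δ.uosDelta s) (Δ'.uosDelta t) := by
  exact ⟨Δ.uosProdEquiv Δ', ⟨Δ.uosProdEquiv_star Δ', fun n =>
    ⟨fun _ => Δ.map_uosProdEquiv_mem_pos Δ', fun _ => Δ.map_uosProdEquiv_symm_mem_pos Δ'⟩⟩,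
    Δ.uosProdEquiv_unit Δ', Δ.uosProdEquiv_uosDelta Δ'⟩
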